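/- Setting. Nodes $a_1,a_2,\dots$ decide sequentially between $H_0$ and $H_1$, which have prior probabilities $\pi_0,\pi_1>0$, $\pi_0+\pi_1=1$. Under $H_j$ the private signals $X_1,X_2,\dots$ are i.i.d. with law $\mathbb P^X_j$ on a measurable space $(S,\mathcal S)$; $\mathbb P^X_0$ and $\mathbb P^X_1$ are equivalent, and the likelihood ratio $L_X=d\mathbb P^X_1/d\mathbb P^X_0$ is unbounded, i.e. $\inf_{S'}L_X=0$ and $\sup_{S'}L_X=\infty$ on every measurable $S'\subset S$ with $\tfrac12(\mathbb P^X_0+\mathbb P^X_1)(S')=1$. Node $a_k$ observes $X_k$ and the broadcasts $\hat d_{k-1},\dots,\hat d_{k-m_k}$ of its $m_k\le k-1$ immediate predecessors, and makes a decision $d_k\in\{0,1\}$ by a likelihood ratio test with a threshold $t_k>0$: $d_k=1$ if and only if $L_X(X_k)\,L^k_D(\hat d_{k-1},\dots,\hat d_{k-m_k})>t_k$, where $L_D^k(D)=\mathbb P_1(\hat d_{k-1},\dots,\hat d_{k-m_k}=D)/\mathbb P_0(\hat d_{k-1},\dots,\hat d_{k-m_k}=D)$. Its decision is broadcast through a memoryless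 erasure channel: given $d_k=j$, independently of everything else, $\hat d_k$ is the erasure symbol $e$ with probability $p_{k,j}=\mathbb P(\hat d_k=e\mid d_k=j)$ and $\hat d_k=j$ otherwise. A decision strategy is a sequence of thresholds $t_k>0$, and its error probability is $\mathbb P_e^k=\pi_0\mathbb P_0(d_k=1)+\pi_1\mathbb P_1(d_k=0)$. Let $n_k$ be the largest integer $n\ge 0$ with $k-n^2\ge 1$ such that each of the nodes $a_{k-n^2},\dots,a_k$ has a memory size of at least $n$. Theorem. Suppose that $m_k\to\infty$ and that, for some $\varepsilon>1$ and $c>0$, at least one of the following holds: (a) for all sufficiently large $k$, the $n_k$ immediate predecessors of $a_k$ satisfy $p_{i,j}\le (c\,n_k)^{-\varepsilon/n_k}$ for $k-n_k\le i\le k-1$ and $j=0,1$; (b) $p_{k,j}\le (c\,n_k)^{-\varepsilon/n_k}$ for all sufficiently large $k$ and $j=0,1$, and there is a constant $K$ such that for all sufficiently large $k$, $n_i\le K n_k$ for $k-n_k\le i\le k-1$ (for instance, $K=1$ if the memory sizes $m_k$ are non-decreasing). Then there is a decision strategy such that $\mathbb P_e^k\to 0$ as $k\to\infty$. In particular, the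 erasure probabilities may tend to $1$. -/

import Mathlib

open Filter Topology MeasureTheory
open scoped NNReal ENNReal

/-- The data of the sequential binary hypothesis testing problem with broadcast erasures.
`false` and `true` stand for the hypotheses `H₀`, `H₁` and for the decisions `0`, `1`.
The nodes are numbered `0, 1, 2, …`, so that node `k` has exactly `k` predecessors. -/
structure ErasureNetwork (S : Type*) [MeasurableSpace S] where
  /-- the common law of the private signals under each hypothesis -/
  signalLaw : Bool → Measure S
  isProb : ∀ j, IsProbabilityMeasure (signalLaw j)
  /-- the prior probabilities of the two hypotheses (nonzero) -/
  prior : Bool → ℝ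
  prior_pos : ∀ j, 0 < prior j
  prior_add : prior false + prior true = 1
  /-- the memory size: node `k` observes its `memory k` immediate predecessors -/
  memory : ℕ → ℕ
  memory_le : ∀ k, memory k ≤ k
  /-- `erasureProb k j` is the probability that the broadcast of node `k` is erased,
  given that its decision is `j` -/
  erasureProb : ℕ → Bool → ℝ≥0
  erasureProb_le_one : ∀ k j, erasureProb k j ≤ 1

namespace ErasureNetwork

/-- Channel outputs: `none` is the erasure symbol `e`, `some i` is the unerased decision `i`. -/
abbrev Symbol : Type := Option Bool

/-- The broadcasts of the first `k` nodes, most recent first: entry `0` is the broadcast of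
node `k - 1`, entry `1` that of node `k - 2`, and so on. -/
abbrev History (k : ℕ) : Type := Fin k → Symbol

variable {S : Type*} [MeasurableSpace S]

/-- The likelihood ratio `dP₁ / dP₀` of a private signal. -/
noncomputable def signalLR (N : ErasureNetwork S) : S → ℝ≥0∞ :=
  (N.signalLaw true).rnDeriv (N.signalLaw false)

/-- What node `k` sees of the history: the `memory k` most recent broadcasts. -/
def observed (N : ErasureNetwork S) (k : ℕ) (h : History k) : History (N.memory k) :=
  fun i => h (Fin.castLE (N.memory_le k) i)

/-- The likelihood ratio of the broadcasts `D` observed by node `k`, when `P j` is the law of the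
whole history under hypothesis `j`. -/
noncomputable def observedLR (N : ErasureNetwork S) (k : ℕ) (P : Bool → PMF (History k))
    (D : History (N.memory k)) : ℝ≥0∞ :=
  (P true).map (N.observed k) D / (P false).map (N.observed k) D

open Classical in
/-- The likelihood ratio test with threshold `t`: decide `1` if and only if the product of the
likelihood ratio of the private signal and of that of the observed broadcasts exceeds `t`. -/
noncomputable def test (N : ErasureNetwork S) (t : ℝ) (LD : ℝ≥0∞) (s : S) : Bool :=
  decide (ENNReal.ofReal t < N.signalLR s * LD)

theorem measurable_test (N : ErasureNetwork S) (t : ℝ) (LD : ℝ≥0∞) :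
    Measurable (N.test t LD) := by
  refine measurable_to_bool ?_
  have h : N.test t LD ⁻¹' {true} = {s | ENNReal.ofReal t < N.signalLR s * LD} := by
    ext s; simp [test]
  rw [h]
  exact measurableSet_lt measurable_const
    ((Measure.measurable_rnDeriv _ _).mul measurable_const)

/-- The law, under hypothesis `j`, of the decision of node `k` given the history `h`: a private
signal is drawn from `signalLaw j`, independently of the history, and the test is applied. -/
noncomputable def decisionLaw (N : ErasureNetwork S) (t : ℝ) (k : ℕ)
    (P : Bool → PMF (History k)) (j : Bool) (h : History k) : PMF Bool :=
  haveI := N.isProb j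
  haveI : IsProbabilityMeasure
      ((N.signalLaw j).map (N.test t (N.observedLR k P (N.observed k h)))) :=
    Measure.isProbabilityMeasure_map (N.measurable_test _ _).aemeasurable
  ((N.signalLaw j).map (N.test t (N.observedLR k P (N.observed k h)))).toPMF

/-- The binary erasure channel of node `k`: the input `d` is erased with probability
`erasureProb k d` and is transmitted correctly otherwise. -/
noncomputable def channel (N : ErasureNetwork S) (k : ℕ) (d : Bool) : PMF Symbol :=
  PMF.ofFintype
    (fun x => match x with
      | none => (N.erasureProb k d : ℝ≥0∞)
      | some i => if i = d then 1 - (N.erasureProb k d : ℝ≥0∞) else 0)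
    (by
      have h : (N.erasureProb k d : ℝ≥0∞) ≤ 1 := by
        exact_mod_cast N.erasureProb_le_one k d
      rw [Fintype.sum_option]
      simp [add_tsub_cancel_of_le h])

/-- The joint law of the first `k` broadcasts under each hypothesis, when node `k` uses the
likelihood ratio test with threshold `t k`. -/
noncomputable def historyLaw (N : ErasureNetwork S) (t : ℕ → ℝ) :
    (k : ℕ) → Bool → PMF (History k)
  | 0, _ => PMF.pure Fin.elim0
  | k + 1, j =>
      (N.historyLaw t k j).bind fun h =>
        (N.decisionLaw (t k) k (N.historyLaw t k) j h).bind fun d =>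
          (N.channel k d).map fun x => (Fin.cons x h : History (k + 1))

/-- The law of the decision of node `k` under hypothesis `j`. -/
noncomputable def nodeLaw (N : ErasureNetwork S) (t : ℕ → ℝ) (k : ℕ) (j : Bool) : PMF Bool :=
  (N.historyLaw t k j).bind fun h => N.decisionLaw (t k) k (N.historyLaw t k) j h

/-- The error probability `π₀ P₀(d_k = 1) + π₁ P₁(d_k = 0)` of node `k`. -/
noncomputable def errorProb (N : ErasureNetwork S) (t : ℕ → ℝ) (k : ℕ) : ℝ :=
  N.prior false * (N.nodeLaw t k false true).toReal +
    N.prior true * (N.nodeLaw t k true false).toReal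

/-- The two laws of a private signal are equivalent measures. -/
def EquivalentSignals (N : ErasureNetwork S) : Prop :=
  N.signalLaw false ≪ N.signalLaw true ∧ N.signalLaw true ≪ N.signalLaw false

/-- The likelihood ratio of a private signal is unbounded: on every set of probability one under
`(P₀ + P₁) / 2`, its infimum is `0` and its supremum is `∞`. -/
def UnboundedSignals (N : ErasureNetwork S) : Prop :=
  ∀ S' : Set S, MeasurableSet S' →
    ((2 : ℝ≥0∞)⁻¹ • (N.signalLaw false + N.signalLaw true)) S' = 1 →
      (⨅ s ∈ S', N.signalLR s) = 0 ∧ (⨆ s ∈ S', N.signalLR s) = ∞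

open Classical in
/-- The number `n_k`: the largest `n` such that the nodes `k - n², …, k` exist and each of them
has a memory size of at least `n` (such an `n` is at most `k`, and `n = 0` qualifies). -/
noncomputable def searchLength (N : ErasureNetwork S) (k : ℕ) : ℕ :=
  Nat.findGreatest (fun n => n ^ 2 ≤ k ∧ ∀ i ∈ Finset.Icc (k - n ^ 2) k, n ≤ N.memory i) k

end ErasureNetwork


/-!
Every node uses the maximum a posteriori test, so its error probability is at most that of any
randomized test of its signal and the broadcasts it observes. The test to compare with discards
some of the unerased broadcasts, so that what is left of the broadcast of node `i` is erased with
probability `max (p i 0) (p i 1)` whatever the decision was. It searches its window for the most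
recent broadcast left, and overrides the decision found there if the private signal is decisive
enough against it. Because the likelihood ratio is unbounded, this overriding lowers the error
probability of the decision found by a fixed amount as long as it is not small already, and the
search fails only if the whole window is erased, an event whose probability tends to `0`. Passing
to the upper limit of the error probabilities shows that it vanishes.
-/

section LikelihoodRatio

variable {α : Type*} [MeasurableSpace α] {μ ν : Measure α}

theorem measure_rnDeriv_lt_le [ν.HaveLebesgueDecomposition μ] (hνμ : ν ≪ μ) (c : ℝ≥0∞) :
    ν {x | ν.rnDeriv μ x < c} ≤ c * μ {x | ν.rnDeriv μ x < c} := by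
  have hm : MeasurableSet {x | ν.rnDeriv μ x < c} :=
    measurableSet_lt (Measure.measurable_rnDeriv _ _) measurable_const
  rw [← Measure.setLIntegral_rnDeriv' hνμ hm, ← setLIntegral_const]
  exact setLIntegral_mono' hm fun x hx => le_of_lt hx

theorem mul_measure_lt_rnDeriv_le (c : ℝ≥0∞) :
    c * μ {x | c < ν.rnDeriv μ x} ≤ ν {x | c < ν.rnDeriv μ x} := by
  have hm : MeasurableSet {x | c < ν.rnDeriv μ x} :=
    measurableSet_lt measurable_const (Measure.measurable_rnDeriv _ _)
  rw [← setLIntegral_const]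
  exact (setLIntegral_mono' hm fun x hx => le_of_lt hx).trans (Measure.setLIntegral_rnDeriv_le _)

/-- Both sides are integrals with respect to `μ`; on the left the integrand is everywhere the
smaller one of `a` and `b * ν.rnDeriv μ`. -/
theorem neyman_pearson [ν.HaveLebesgueDecomposition μ] (hνμ : ν ≪ μ) {a b : ℝ≥0∞} {A B : Set α}
    (hA : MeasurableSet A) (hB : MeasurableSet B) (hin : ∀ x ∈ B, a ≤ b * ν.rnDeriv μ x)
    (hout : ∀ x ∉ B, b * ν.rnDeriv μ x ≤ a) :
    a * μ B + b * ν Bᶜ ≤ a * μ A + b * ν Aᶜ := by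
  have hcost : ∀ C, MeasurableSet C →
      a * μ C + b * ν Cᶜ = ∫⁻ _ in C, a ∂μ + ∫⁻ x in Cᶜ, b * ν.rnDeriv μ x ∂μ := fun C hC => by
    rw [lintegral_const_mul _ (Measure.measurable_rnDeriv _ _),
      Measure.setLIntegral_rnDeriv' hνμ hC.compl, setLIntegral_const]
  let m x := min a (b * ν.rnDeriv μ x)
  calc a * μ B + b * ν Bᶜ
      = ∫⁻ _ in B, a ∂μ + ∫⁻ x in Bᶜ, b * ν.rnDeriv μ x ∂μ := hcost B hB
    _ ≤ ∫⁻ x in B, m x ∂μ + ∫⁻ x in Bᶜ, m x ∂μ :=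
        add_le_add (setLIntegral_mono' hB fun x hx => le_min le_rfl (hin x hx))
          (setLIntegral_mono' hB.compl fun x hx => le_min (hout x hx) le_rfl)
    _ = ∫⁻ x in A, m x ∂μ + ∫⁻ x in Aᶜ, m x ∂μ := by
        rw [lintegral_add_compl _ hB, lintegral_add_compl _ hA]
    _ ≤ ∫⁻ _ in A, a ∂μ + ∫⁻ x in Aᶜ, b * ν.rnDeriv μ x ∂μ :=
        add_le_add (lintegral_mono fun _ => min_le_left _ _)
          (lintegral_mono fun _ => min_le_right _ _)
    _ = a * μ A + b * ν Aᶜ := (hcost A hA).symm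

end LikelihoodRatio

section Threshold

variable {p₀ p₁ q₀ q₁ x : ℝ≥0∞}

theorem mul_le_mul_mul_of_div_lt (hp₁ : p₁ ≠ 0) (hp₁' : p₁ ≠ ∞) (h : p₀ / p₁ < x * (q₁ / q₀)) :
    p₀ * q₀ ≤ p₁ * q₁ * x := by
  calc p₀ * q₀ ≤ x * (q₁ / q₀) * p₁ * q₀ := by
        gcongr
        exact (ENNReal.div_le_iff hp₁ hp₁').1 h.le
    _ = p₁ * (q₀ * (q₁ / q₀)) * x := by ring
    _ ≤ p₁ * q₁ * x := by
        gcongr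
        exact ENNReal.mul_div_le

theorem mul_mul_le_mul_of_le_div (hp₀ : p₀ ≠ ∞) (hp₁ : p₁ ≠ 0) (hq₀ : q₀ ≠ ∞)
    (h : x * (q₁ / q₀) ≤ p₀ / p₁) : p₁ * q₁ * x ≤ p₀ * q₀ := by
  rcases eq_or_ne q₀ 0 with rfl | hq₀'
  · -- `q₁ / 0` is `∞` unless `q₁ = 0`
    have hx : x * (q₁ / 0) ≠ ∞ := (h.trans_lt (ENNReal.div_lt_top hp₀ hp₁)).ne
    rcases eq_or_ne q₁ 0 with rfl | hq₁
    · simp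
    · have : x = 0 := by_contra fun hx0 => hx (by rw [ENNReal.div_zero hq₁, ENNReal.mul_top hx0])
      simp [this]
  · calc p₁ * q₁ * x = p₁ * (x * (q₁ / q₀)) * q₀ := by
          rw [mul_assoc p₁ _ q₀, mul_assoc x, ENNReal.div_mul_cancel hq₀' hq₀, mul_assoc,
            mul_comm x]
      _ ≤ p₁ * (p₀ / p₁) * q₀ := by gcongr
      _ ≤ p₀ * q₀ := by
          gcongr
          exact ENNReal.mul_div_le

end Threshold

section Expectation

variable {α β : Type*} [Fintype α]

/-- The expectation of a real function under a probability mass function on a finite type. -/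
noncomputable def pmfExpect (p : PMF α) (f : α → ℝ) : ℝ :=
  ∑ a, (p a).toReal * f a

theorem sum_toReal_pmf (p : PMF α) : ∑ a, (p a).toReal = 1 := by
  rw [← ENNReal.toReal_sum fun a _ => p.apply_ne_top a, ← tsum_fintype (L := .unconditional _),
    p.tsum_coe, ENNReal.toReal_one]

theorem pmfExpect_add (p : PMF α) (f g : α → ℝ) :
    pmfExpect p (fun a => f a + g a) = pmfExpect p f + pmfExpect p g := by
  simp only [pmfExpect, mul_add, Finset.sum_add_distrib]

theorem pmfExpect_const_mul (p : PMF α) (c : ℝ) (f : α → ℝ) :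
    pmfExpect p (fun a => c * f a) = c * pmfExpect p f := by
  simp only [pmfExpect, Finset.mul_sum, mul_left_comm]

theorem pmfExpect_const (p : PMF α) (c : ℝ) : pmfExpect p (fun _ => c) = c := by
  rw [pmfExpect, ← Finset.sum_mul, sum_toReal_pmf, one_mul]

theorem pmfExpect_pure (a : α) (f : α → ℝ) : pmfExpect (PMF.pure a) f = f a := by
  classical
  simp [pmfExpect, PMF.pure_apply, apply_ite ENNReal.toReal]

theorem toReal_bind_apply (p : PMF α) (q : α → PMF β) (b : β) :
    (p.bind q b).toReal = pmfExpect p fun a => (q a b).toReal := by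
  rw [PMF.bind_apply, tsum_fintype, ENNReal.toReal_sum fun a _ =>
    ENNReal.mul_ne_top (p.apply_ne_top a) ((q a).apply_ne_top b)]
  simp only [pmfExpect, ENNReal.toReal_mul]

theorem pmfExpect_bind [Fintype β] (p : PMF α) (q : α → PMF β) (f : β → ℝ) :
    pmfExpect (p.bind q) f = pmfExpect p fun a => pmfExpect (q a) f := by
  simp only [pmfExpect, toReal_bind_apply, Finset.sum_mul, Finset.mul_sum, mul_assoc]
  exact Finset.sum_comm

theorem pmfExpect_map [Fintype β] (p : PMF α) (g : α → β) (f : β → ℝ) :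
    pmfExpect (p.map g) f = pmfExpect p fun a => f (g a) := by
  simp only [← PMF.bind_pure_comp, pmfExpect_bind, Function.comp_apply, pmfExpect_pure]

theorem sum_bool_eq_add_not (g : Bool → ℝ) (j : Bool) : ∑ i, g i = g j + g (!j) := by
  cases j <;> simp [add_comm]

theorem pmfExpect_bool (p : PMF Bool) (f : Bool → ℝ) (j : Bool) :
    pmfExpect p f = (1 - (p (!j)).toReal) * f j + (p (!j)).toReal * f (!j) := by
  have h : (p j).toReal + (p (!j)).toReal = 1 := by
    rw [← sum_bool_eq_add_not (fun d => (p d).toReal), sum_toReal_pmf]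
  rw [pmfExpect, sum_bool_eq_add_not _ j, ← h, add_sub_cancel_right]

end Expectation

section Window

theorem rpow_neg_div_le_rpow_neg_div {ε c x y : ℝ} (hε : 0 ≤ ε) (hc : 0 < c)
    (hx : Real.exp 1 ≤ c * x) (hxy : x ≤ y) : (c * x) ^ (-ε / x) ≤ (c * y) ^ (-ε / y) := by
  have hcx : 0 < c * x := (Real.exp_pos 1).trans_le hx
  have hcxy : c * x ≤ c * y := mul_le_mul_of_nonneg_left hxy hc.le
  have hlog : ∀ z, Real.log (c * z) * (-ε / z) = -(ε * c * (Real.log (c * z) / (c * z))) := by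
    intro z
    rcases eq_or_ne z 0 with rfl | hz
    · simp
    · field_simp
  rw [Real.rpow_def_of_pos hcx, Real.rpow_def_of_pos (hcx.trans_le hcxy), Real.exp_le_exp,
    hlog, hlog, neg_le_neg_iff]
  exact mul_le_mul_of_nonneg_left (Real.log_div_self_antitoneOn hx (hx.trans hcxy) hcxy)
    (mul_nonneg hε hc.le)

variable {p : ℕ → ℝ} {n : ℕ → ℕ} {ε c : ℝ}

theorem tendsto_prod_window_of_le_rpow (hp : ∀ i, 0 ≤ p i) (hn_le : ∀ k, n k ≤ k)
    (hn : Tendsto n atTop atTop) (hε : 0 < ε) (hc : 0 < c)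
    (hbound : ∀ᶠ k in atTop, ∀ i ∈ Finset.Ico (k - n k) k,
      p i ≤ (c * n k) ^ (-ε / (n k : ℝ))) :
    Tendsto (fun k => ∏ i ∈ Finset.Ico (k - n k) k, p i) atTop (𝓝 0) := by
  have hlim : Tendsto (fun k => (c * (n k : ℝ)) ^ (-ε)) atTop (𝓝 0) :=
    (tendsto_rpow_neg_atTop hε).comp
      ((tendsto_natCast_atTop_atTop.comp hn).const_mul_atTop hc)
  refine squeeze_zero' (.of_forall fun k => Finset.prod_nonneg fun _ _ => hp _) ?_ hlim
  filter_upwards [hbound, hn.eventually_ge_atTop 1] with k hk hk1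
  have hpos : (0 : ℝ) < n k := by exact_mod_cast hk1
  calc ∏ i ∈ Finset.Ico (k - n k) k, p i
      ≤ ∏ _ ∈ Finset.Ico (k - n k) k, (c * (n k : ℝ)) ^ (-ε / (n k : ℝ)) :=
        Finset.prod_le_prod (fun i _ => hp i) hk
    _ = (c * (n k : ℝ)) ^ (-ε) := by
        rw [Finset.prod_const, Nat.card_Ico, Nat.sub_sub_self (hn_le k), ← Real.rpow_natCast,
          ← Real.rpow_mul (by positivity), div_mul_cancel₀ _ hpos.ne']

theorem tendsto_prod_window_of_le_rpow_self (hp : ∀ i, 0 ≤ p i) (hn_le : ∀ k, n k ≤ k)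
    (hn : Tendsto n atTop atTop) (hstart : Tendsto (fun k => k - n k) atTop atTop)
    (hε : 0 < ε) (hc : 0 < c) (hbound : ∀ᶠ k in atTop, p k ≤ (c * n k) ^ (-ε / (n k : ℝ)))
    {K : ℝ} (hK : ∀ᶠ k in atTop, ∀ i ∈ Finset.Ico (k - n k) k, (n i : ℝ) ≤ K * n k) :
    Tendsto (fun k => ∏ i ∈ Finset.Ico (k - n k) k, p i) atTop (𝓝 0) := by
  set L := max K 1
  have hL : 0 < L := zero_lt_one.trans_le (le_max_right _ _)
  -- `(c * x) ^ (-ε / x)` at `x = L * n k` is the bound for the constants `c * L` and `ε / L`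
  refine tendsto_prod_window_of_le_rpow hp hn_le hn (div_pos hε hL) (mul_pos hc hL) ?_
  have hlarge : ∀ᶠ i in atTop, Real.exp 1 ≤ c * (n i : ℝ) :=
    ((tendsto_natCast_atTop_atTop.comp hn).const_mul_atTop hc).eventually_ge_atTop _
  obtain ⟨k₀, hk₀⟩ := eventually_atTop.1 (hbound.and hlarge)
  filter_upwards [hK, hstart.eventually_ge_atTop k₀] with k hKk hk i hi
  obtain ⟨hpi, hni⟩ := hk₀ i (hk.trans (Finset.mem_Ico.1 hi).1)
  have hle : (n i : ℝ) ≤ L * n k :=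
    (hKk i hi).trans (mul_le_mul_of_nonneg_right (le_max_left _ _) (Nat.cast_nonneg _))
  calc p i ≤ (c * n i) ^ (-ε / (n i : ℝ)) := hpi
    _ ≤ (c * (L * n k)) ^ (-ε / (L * n k)) := rpow_neg_div_le_rpow_neg_div hε.le hc hni hle
    _ = (c * L * n k) ^ (-(ε / L) / (n k : ℝ)) := by rw [mul_assoc, neg_div, neg_div, div_div]

theorem tendsto_zero_of_window_improvement {e b : ℕ → ℝ} {C : ℝ} (he : ∀ k, 0 ≤ e k)
    (heC : ∀ k, e k ≤ C) (hstart : Tendsto (fun k => k - n k) atTop atTop)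
    (hb : Tendsto b atTop (𝓝 0))
    (himp : ∀ δ > 0, ∃ η > 0, ∀ k M, (∀ i ∈ Finset.Ico (k - n k) k, e i ≤ M) →
      e k ≤ max δ (M - η) + b k) :
    Tendsto e atTop (𝓝 0) := by
  have hbdd : IsBoundedUnder (· ≤ ·) atTop e := isBoundedUnder_of ⟨C, heC⟩
  have hbdd' : IsBoundedUnder (· ≥ ·) atTop e := isBoundedUnder_of ⟨0, he⟩
  suffices hlimsup : limsup e atTop ≤ 0 from
    tendsto_of_le_liminf_of_limsup_le
      (le_liminf_of_le hbdd.isCoboundedUnder_ge (.of_forall he)) hlimsup hbdd hbdd'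
  refine le_of_forall_pos_le_add fun ρ hρ => ?_
  obtain ⟨η, hη, hstep⟩ := himp (ρ / 2) (half_pos hρ)
  obtain ⟨k₀, hk₀⟩ := eventually_atTop.1
    (eventually_lt_of_limsup_lt (lt_add_of_pos_right (limsup e atTop) (half_pos hη)) hbdd)
  have hev : ∀ᶠ k in atTop,
      e k ≤ max (ρ / 2) (limsup e atTop + η / 2 - η) + min (ρ / 2) (η / 4) := by
    filter_upwards [hstart.eventually_ge_atTop k₀,
      hb.eventually_le_const (show (0 : ℝ) < min (ρ / 2) (η / 4) by positivity)] with k hk hbk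
    refine (hstep k _ fun i hi => ?_).trans (add_le_add_right hbk _)
    exact (hk₀ i (hk.trans (Finset.mem_Ico.1 hi).1)).le
  have hle := limsup_le_of_le hbdd'.isCoboundedUnder_le hev
  rcases le_max_iff.1 (sub_le_iff_le_add.2 hle) with h | h <;>
    linarith [min_le_left (ρ / 2) (η / 4), min_le_right (ρ / 2) (η / 4)]

end Window


namespace ErasureNetwork

variable {S : Type*} [MeasurableSpace S] (N : ErasureNetwork S)

section Signal

theorem measurable_signalLR : Measurable N.signalLR :=
  Measure.measurable_rnDeriv _ _

variable {N} in
theorem UnboundedSignals.signalLR_compl_of_null (hunbdd : N.UnboundedSignals) {A : Set S}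
    (hA : MeasurableSet A) (hnull : ∀ j, N.signalLaw j A = 0) :
    (⨅ s ∈ Aᶜ, N.signalLR s) = 0 ∧ (⨆ s ∈ Aᶜ, N.signalLR s) = ∞ := by
  have hone : ∀ j, N.signalLaw j Aᶜ = 1 := fun j =>
    have := N.isProb j
    (prob_compl_eq_one_iff hA).2 (hnull j)
  refine hunbdd _ hA.compl ?_
  rw [Measure.smul_apply, Measure.add_apply, hone, hone, one_add_one_eq_two, smul_eq_mul,
    ENNReal.inv_mul_cancel two_ne_zero ENNReal.ofNat_ne_top]

/-- The event is that the likelihood ratio is below `τ` for `j = false` and above `1 / τ` for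
`j = true`. -/
theorem exists_decisive_event (hac : N.signalLaw true ≪ N.signalLaw false)
    (hunbdd : N.UnboundedSignals) {τ : ℝ} (hτ : 0 < τ) (j : Bool) :
    ∃ A, MeasurableSet A ∧ 0 < (N.signalLaw j).real A ∧
      (N.signalLaw (!j)).real A ≤ τ * (N.signalLaw j).real A := by
  have := N.isProb
  have hτ₀ : ENNReal.ofReal τ ≠ 0 := (ENNReal.ofReal_pos.2 hτ).ne'
  suffices h : ∃ A, MeasurableSet A ∧ N.signalLaw (!j) A ≤ ENNReal.ofReal τ * N.signalLaw j A ∧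
      ¬ ∀ i, N.signalLaw i A = 0 by
    obtain ⟨A, hA, hle, hnull⟩ := h
    have hpos : N.signalLaw j A ≠ 0 := fun h0 => hnull fun i => by
      rcases Bool.eq_or_eq_not i j with rfl | rfl
      · exact h0
      · simpa [h0] using hle
    refine ⟨A, hA, ENNReal.toReal_pos hpos (measure_ne_top _ _), ?_⟩
    simpa [Measure.real, hτ.le] using ENNReal.toReal_mono (by finiteness) hle
  cases j with
  | false =>
    refine ⟨{s | N.signalLR s < ENNReal.ofReal τ},
      measurableSet_lt N.measurable_signalLR measurable_const, measure_rnDeriv_lt_le hac _,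
      fun hnull => ?_⟩
    have hinf := (hunbdd.signalLR_compl_of_null
      (measurableSet_lt N.measurable_signalLR measurable_const) hnull).1
    exact hτ₀ (nonpos_iff_eq_zero.1 (hinf ▸ le_iInf₂ fun s hs => not_lt.1 hs))
  | true =>
    refine ⟨{s | (ENNReal.ofReal τ)⁻¹ < N.signalLR s},
      measurableSet_lt measurable_const N.measurable_signalLR, ?_, fun hnull => ?_⟩
    · rw [← ENNReal.inv_mul_le_iff hτ₀ ENNReal.ofReal_ne_top]
      exact mul_measure_lt_rnDeriv_le _
    · have hsup := (hunbdd.signalLR_compl_of_null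
        (measurableSet_lt measurable_const N.measurable_signalLR) hnull).2
      exact ENNReal.inv_ne_top.2 hτ₀ (top_le_iff.1 (hsup ▸ iSup₂_le fun s hs => not_lt.1 hs))

end Signal

section Risk

/-- The probability under hypothesis `j` that the decision `φ`, a function of the private signal,
is wrong. -/
noncomputable def testError (φ : S → Bool) (j : Bool) : ℝ :=
  (N.signalLaw j).real (φ ⁻¹' {!j})

/-- The error probabilities, as functions of the hypothesis, of the randomized decisions based on
the private signal. A randomized decision is encoded as a convex combination of deterministic
ones. -/
def riskSet : Set (Bool → ℝ) :=
  convexHull ℝ (N.testError '' {φ | Measurable φ})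

theorem testError_mem_riskSet {φ : S → Bool} (hφ : Measurable φ) : N.testError φ ∈ N.riskSet :=
  subset_convexHull ℝ _ (Set.mem_image_of_mem _ hφ)

theorem testError_le_one (φ : S → Bool) (j : Bool) : N.testError φ j ≤ 1 :=
  have := N.isProb j
  measureReal_le_one

/-- The threshold of the maximum a posteriori test. -/
noncomputable def priorOdds : ℝ :=
  N.prior false / N.prior true

theorem priorOdds_pos : 0 < N.priorOdds :=
  div_pos (N.prior_pos _) (N.prior_pos _)

theorem mapTest_testError_le (hac : N.signalLaw true ≪ N.signalLaw false) {q : Bool → ℝ≥0∞}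
    (hq : ∀ j, q j ≠ ∞) {φ : S → Bool} (hφ : Measurable φ) :
    ∑ j, N.prior j * (q j).toReal * N.testError (N.test N.priorOdds (q true / q false)) j ≤
      ∑ j, N.prior j * (q j).toReal * N.testError φ j := by
  have := N.isProb
  let p j := ENNReal.ofReal (N.prior j)
  have hp : p true ≠ 0 := (ENNReal.ofReal_pos.2 (N.prior_pos true)).ne'
  have hp' : ∀ j, p j ≠ ∞ := fun _ => ENNReal.ofReal_ne_top
  have hfin : ∀ j A, p j * q j * N.signalLaw j A ≠ ∞ := fun j A =>
    ENNReal.mul_ne_top (ENNReal.mul_ne_top (hp' j) (hq j)) (measure_ne_top _ _)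
  have hcost : ∀ ψ : S → Bool, ∑ j, N.prior j * (q j).toReal * N.testError ψ j =
      (p false * q false * N.signalLaw false (ψ ⁻¹' {true}) +
        p true * q true * N.signalLaw true (ψ ⁻¹' {true})ᶜ).toReal := by
    intro ψ
    have hcompl : (ψ ⁻¹' {true})ᶜ = ψ ⁻¹' {false} := by ext s; simp
    rw [ENNReal.toReal_add (hfin _ _) (hfin _ _), hcompl, sum_bool_eq_add_not _ false]
    simp [testError, Measure.real, p, (N.prior_pos _).le]
  have hmem : ∀ s, s ∈ N.test N.priorOdds (q true / q false) ⁻¹' {true} ↔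
      p false / p true < N.signalLR s * (q true / q false) := by
    intro s
    simp [test, priorOdds, p, ENNReal.ofReal_div_of_pos (N.prior_pos true)]
  rw [hcost, hcost]
  refine ENNReal.toReal_mono (ENNReal.add_ne_top.2 ⟨hfin _ _, hfin _ _⟩) (neyman_pearson hac
    (hφ (measurableSet_singleton _)) (N.measurable_test _ _ (measurableSet_singleton _))
    (fun s hs => ?_) fun s hs => ?_)
  · exact mul_le_mul_mul_of_div_lt hp (hp' _) ((hmem s).1 hs)
  · exact mul_mul_le_mul_of_le_div (hp' _) hp (hq _) (not_lt.1 fun h => hs ((hmem s).2 h))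

theorem mapTest_testError_le_of_mem_riskSet (hac : N.signalLaw true ≪ N.signalLaw false)
    {q : Bool → ℝ≥0∞} (hq : ∀ j, q j ≠ ∞) {e : Bool → ℝ} (he : e ∈ N.riskSet) :
    ∑ j, N.prior j * (q j).toReal * N.testError (N.test N.priorOdds (q true / q false)) j ≤
      ∑ j, N.prior j * (q j).toReal * e j := by
  have hlin : IsLinearMap ℝ fun e : Bool → ℝ => ∑ j, N.prior j * (q j).toReal * e j :=
    ⟨fun _ _ => by simp only [Pi.add_apply, mul_add, Finset.sum_add_distrib],
      fun _ _ => by simp only [Pi.smul_apply, smul_eq_mul, Finset.mul_sum, mul_left_comm]⟩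
  refine convexHull_min ?_ (convex_halfSpace_ge hlin _) he
  rintro _ ⟨φ, hφ, rfl⟩
  exact N.mapTest_testError_le hac hq hφ

end Risk

section ErrorProb

theorem errorProb_eq_sum (t : ℕ → ℝ) (k : ℕ) :
    N.errorProb t k = ∑ j, N.prior j * (N.nodeLaw t k j (!j)).toReal := by
  rw [sum_bool_eq_add_not _ false]
  rfl

theorem errorProb_nonneg (t : ℕ → ℝ) (k : ℕ) : 0 ≤ N.errorProb t k := by
  rw [errorProb_eq_sum]
  exact Finset.sum_nonneg fun j _ => mul_nonneg (N.prior_pos j).le ENNReal.toReal_nonneg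

theorem sum_prior : ∑ j, N.prior j = 1 := by
  rw [sum_bool_eq_add_not _ false]
  exact N.prior_add

theorem toReal_nodeLaw_le_one (t : ℕ → ℝ) (k : ℕ) (j d : Bool) :
    (N.nodeLaw t k j d).toReal ≤ 1 :=
  ENNReal.toReal_le_of_le_ofReal zero_le_one (by simpa using PMF.coe_le_one _ _)

theorem errorProb_le_one (t : ℕ → ℝ) (k : ℕ) : N.errorProb t k ≤ 1 := by
  rw [errorProb_eq_sum, ← N.sum_prior]
  exact Finset.sum_le_sum fun j _ =>
    mul_le_of_le_one_right (N.prior_pos j).le (N.toReal_nodeLaw_le_one t k j _)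

theorem decisionLaw_not (t : ℝ) (k : ℕ) (P : Bool → PMF (History k)) (j : Bool) (h : History k) :
    (N.decisionLaw t k P j h (!j)).toReal =
      N.testError (N.test t (N.observedLR k P (N.observed k h))) j := by
  rw [decisionLaw, Measure.toPMF_apply,
    Measure.map_apply (N.measurable_test _ _) (measurableSet_singleton _)]
  rfl

theorem observed_surjective (k : ℕ) : Function.Surjective (N.observed k) :=
  (Fin.castLE_injective (N.memory_le k)).surjective_comp_right

theorem errorProb_le_of_factorsThrough_observed (hac : N.signalLaw true ≪ N.signalLaw false)
    {t : ℕ → ℝ} {k : ℕ} (ht : t k = N.priorOdds) {f : History k → Bool → ℝ}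
    (hf : ∀ h, f h ∈ N.riskSet) (hobs : f.FactorsThrough (N.observed k)) :
    N.errorProb t k ≤
      ∑ j, N.prior j * pmfExpect (N.historyLaw t k j) fun h => f h j := by
  obtain ⟨e, rfl⟩ := (Function.factorsThrough_iff f).1 hobs
  have he : ∀ D, e D ∈ N.riskSet := (N.observed_surjective k).forall.2 hf
  let Q j := (N.historyLaw t k j).map (N.observed k)
  have hsum : ∀ g : History (N.memory k) → Bool → ℝ,
      ∑ j, N.prior j * pmfExpect (N.historyLaw t k j) (fun h => g (N.observed k h) j) =
        ∑ D, ∑ j, N.prior j * (Q j D).toReal * g D j := by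
    intro g
    rw [Finset.sum_comm]
    refine Finset.sum_congr rfl fun j _ => ?_
    rw [← pmfExpect_map _ (N.observed k) fun D => g D j]
    simp only [pmfExpect, Finset.mul_sum, mul_assoc, Q]
  calc N.errorProb t k
      = ∑ j, N.prior j * pmfExpect (N.historyLaw t k j) fun h => N.testError
          (N.test N.priorOdds (Q true (N.observed k h) / Q false (N.observed k h))) j := by
        simp only [errorProb_eq_sum, nodeLaw, toReal_bind_apply, decisionLaw_not, ht]
        rfl
    _ = ∑ D, ∑ j, N.prior j * (Q j D).toReal *
          N.testError (N.test N.priorOdds (Q true D / Q false D)) j :=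
        hsum fun D => N.testError (N.test N.priorOdds (Q true D / Q false D))
    _ ≤ ∑ D, ∑ j, N.prior j * (Q j D).toReal * e D j :=
        Finset.sum_le_sum fun D _ =>
          N.mapTest_testError_le_of_mem_riskSet hac (fun j => (Q j).apply_ne_top D) (he D)
    _ = ∑ j, N.prior j * pmfExpect (N.historyLaw t k j) fun h => (e ∘ N.observed k) h j :=
        (hsum e).symm

end ErrorProb

section Relay

/-- The error probability of a randomized decision that is based on the decision `d_i` of node `i`
and on an independent private signal, and whose risk given `d_i = d` is `r d`. -/
noncomputable def relayError (t : ℕ → ℝ) (i : ℕ) (r : Bool → Bool → ℝ) : ℝ :=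
  ∑ j, N.prior j * pmfExpect (N.nodeLaw t i j) fun d => r d j

open Classical in
/-- The decision that follows `d` unless the private signal lies in `A`, in which case it
is `j`. -/
noncomputable def override (A : Set S) (j d : Bool) : S → Bool :=
  A.piecewise (fun _ => j) fun _ => d

theorem measurable_override {A : Set S} (hA : MeasurableSet A) (j d : Bool) :
    Measurable (override A j d) :=
  Measurable.piecewise hA measurable_const measurable_const

theorem testError_override_self {A : Set S} (hA : MeasurableSet A) (j : Bool) :
    N.testError (override A j (!j)) j = 1 - (N.signalLaw j).real A := by
  have := N.isProb j
  have h : override A j (!j) ⁻¹' {!j} = Aᶜ := by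
    ext s
    by_cases hs : s ∈ A <;> simp [override, hs]
  rw [testError, h, probReal_compl_eq_one_sub hA]

theorem testError_override_agree (A : Set S) (j : Bool) :
    N.testError (override A j j) j = 0 := by
  simp [testError, override]

theorem testError_override_not (A : Set S) (j : Bool) :
    N.testError (override A j (!j)) (!j) = (N.signalLaw (!j)).real A := by
  have h : override A j (!j) ⁻¹' {!!j} = A := by
    ext s
    by_cases hs : s ∈ A <;> simp [override, hs]
  rw [testError, h]

theorem relayError_override_le (t : ℕ → ℝ) (i : ℕ) {A : Set S} (hA : MeasurableSet A) (j : Bool) :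
    N.relayError t i (fun d => N.testError (override A j d)) ≤
      N.errorProb t i + (N.signalLaw (!j)).real A -
        N.prior j * (N.nodeLaw t i j (!j)).toReal * (N.signalLaw j).real A := by
  have hprior : N.prior (!j) ≤ 1 := by
    have h := N.sum_prior
    rw [sum_bool_eq_add_not _ j] at h
    linarith [N.prior_pos j]
  set ε := (N.nodeLaw t i j (!j)).toReal
  set ε' := (N.nodeLaw t i (!j) j).toReal with hε'
  have hself : pmfExpect (N.nodeLaw t i j) (fun d => N.testError (override A j d) j) =
      ε * (1 - (N.signalLaw j).real A) := by
    rw [pmfExpect_bool _ _ j, testError_override_agree, N.testError_override_self hA]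
    ring
  have hnot : pmfExpect (N.nodeLaw t i (!j)) (fun d => N.testError (override A j d) (!j)) ≤
      ε' + (N.signalLaw (!j)).real A := by
    rw [pmfExpect_bool _ _ (!j), testError_override_not, Bool.not_not, ← hε']
    nlinarith [mul_le_mul_of_nonneg_left (N.testError_le_one (override A j j) (!j))
      (ENNReal.toReal_nonneg : 0 ≤ ε'), mul_nonneg (ENNReal.toReal_nonneg : 0 ≤ ε')
      (measureReal_nonneg : 0 ≤ (N.signalLaw (!j)).real A)]
  have herr : N.errorProb t i = N.prior j * ε + N.prior (!j) * ε' := by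
    rw [errorProb_eq_sum, sum_bool_eq_add_not _ j, Bool.not_not]
  rw [relayError, sum_bool_eq_add_not _ j, hself, herr]
  nlinarith [mul_le_mul_of_nonneg_left hnot (N.prior_pos (!j)).le, mul_le_mul_of_nonneg_right
    hprior (measureReal_nonneg : 0 ≤ (N.signalLaw (!j)).real A)]

theorem exists_relayError_le (hac : N.signalLaw true ≪ N.signalLaw false)
    (hunbdd : N.UnboundedSignals) {δ : ℝ} (hδ : 0 < δ) :
    ∃ η > 0, ∀ t i, ∃ r : Bool → Bool → ℝ, (∀ d, r d ∈ N.riskSet) ∧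
      N.relayError t i r ≤ max δ (N.errorProb t i - η) := by
  choose A hA hpos hle using N.exists_decisive_event hac hunbdd (show 0 < δ / 4 by positivity)
  let x j := (N.signalLaw j).real (A j)
  refine ⟨δ / 4 * min (x false) (x true), mul_pos (by positivity) (lt_min (hpos _) (hpos _)),
    fun t i => ?_⟩
  have hη : ∀ j, min (x false) (x true) ≤ x j := by simp
  let e j := N.prior j * (N.nodeLaw t i j (!j)).toReal
  have herr : N.errorProb t i = e false + e true := by
    rw [errorProb_eq_sum, sum_bool_eq_add_not _ false]
    rfl
  rcases le_or_gt (N.errorProb t i) δ with hsmall | hlarge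
  · refine ⟨fun d => N.testError (override ∅ true d),
      fun d => N.testError_mem_riskSet (measurable_override .empty _ d), le_max_of_le_left ?_⟩
    simpa using (N.relayError_override_le t i .empty true).trans (by simpa using hsmall)
  · obtain ⟨j, hj⟩ : ∃ j, δ / 2 ≤ e j := by
      by_contra! h
      linarith [h false, h true]
    refine ⟨fun d => N.testError (override (A j) j d),
      fun d => N.testError_mem_riskSet (measurable_override (hA j) _ d), le_max_of_le_right ?_⟩
    calc N.relayError t i (fun d => N.testError (override (A j) j d))
        ≤ N.errorProb t i + (N.signalLaw (!j)).real (A j) - e j * x j :=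
          N.relayError_override_le t i (hA j) j
      _ ≤ N.errorProb t i + δ / 4 * x j - δ / 2 * x j := by
          gcongr
          exact hle j
      _ = N.errorProb t i - δ / 4 * x j := by ring
      _ ≤ N.errorProb t i - δ / 4 * min (x false) (x true) := by
          gcongr
          exact hη j

end Relay

section Search

/-- The probability that the broadcast of node `k` is erased after thinning, see `retention`. -/
noncomputable def maxErasure (k : ℕ) : ℝ :=
  max (N.erasureProb k false) (N.erasureProb k true)

theorem maxErasure_nonneg (k : ℕ) : 0 ≤ N.maxErasure k :=
  le_max_of_le_left (NNReal.coe_nonneg _)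

theorem erasureProb_le_maxErasure (k : ℕ) (d : Bool) : N.erasureProb k d ≤ N.maxErasure k := by
  cases d <;> simp [maxErasure]

theorem maxErasure_le {k : ℕ} {b : ℝ} (h : ∀ d, (N.erasureProb k d : ℝ) ≤ b) :
    N.maxErasure k ≤ b :=
  max_le (h false) (h true)

theorem maxErasure_le_one (k : ℕ) : N.maxErasure k ≤ 1 :=
  N.maxErasure_le (N.erasureProb_le_one k)

/-- The probability with which an unerased broadcast `d` of node `k` is retained, and not
discarded, by nodes that want to see it erased with the same probability whatever the decision
was. If `d` is always erased this is `0 / 0 = 0`. -/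
noncomputable def retention (k : ℕ) (d : Bool) : ℝ :=
  (1 - N.maxErasure k) / (1 - N.erasureProb k d)

theorem retention_nonneg (k : ℕ) (d : Bool) : 0 ≤ N.retention k d :=
  div_nonneg (sub_nonneg.2 (N.maxErasure_le_one k)) (sub_nonneg.2 (N.erasureProb_le_one k d))

theorem retention_le_one (k : ℕ) (d : Bool) : N.retention k d ≤ 1 :=
  div_le_one_of_le₀ (sub_le_sub_left (N.erasureProb_le_maxErasure k d) 1)
    (sub_nonneg.2 (N.erasureProb_le_one k d))

theorem mul_retention (k : ℕ) (d : Bool) :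
    (1 - N.erasureProb k d) * N.retention k d = 1 - N.maxErasure k :=
  mul_div_cancel_of_imp' fun h => le_antisymm
    (h ▸ sub_le_sub_left (N.erasureProb_le_maxErasure k d) 1)
    (sub_nonneg.2 (N.maxErasure_le_one k))

/-- The risk, given the broadcast of node `k`, of the randomized decision with risk `r d` if the
broadcast `d` is received and retained, and with risk `u` if it is erased or discarded. -/
noncomputable def thinnedRisk (k : ℕ) (r : Bool → Bool → ℝ) (u : Bool → ℝ) : Symbol → Bool → ℝ
  | none => u
  | some d => N.retention k d • r d + (1 - N.retention k d) • u

theorem thinnedRisk_mem_riskSet {k : ℕ} {r : Bool → Bool → ℝ} {u : Bool → ℝ}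
    (hr : ∀ d, r d ∈ N.riskSet) (hu : u ∈ N.riskSet) :
    ∀ x, N.thinnedRisk k r u x ∈ N.riskSet
  | none => hu
  | some d => convex_convexHull ℝ _ (hr d) hu (N.retention_nonneg k d)
      (sub_nonneg.2 (N.retention_le_one k d)) (add_sub_cancel _ _)

theorem pmfExpect_channel (k : ℕ) (d : Bool) (f : Symbol → ℝ) :
    pmfExpect (N.channel k d) f =
      N.erasureProb k d * f none + (1 - N.erasureProb k d) * f (some d) := by
  have hnone : (N.channel k d none).toReal = N.erasureProb k d := rfl
  have hsome : (N.channel k d (some d)).toReal = 1 - N.erasureProb k d := by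
    simp [channel, PMF.ofFintype_apply, ENNReal.toReal_sub_of_le, N.erasureProb_le_one k d]
  have hflip : (N.channel k d (some !d)).toReal = 0 := by
    simp [channel, PMF.ofFintype_apply]
  rw [pmfExpect, Fintype.sum_option, sum_bool_eq_add_not _ d, hnone, hsome, hflip, zero_mul,
    add_zero]

theorem pmfExpect_channel_thinnedRisk (k : ℕ) (d : Bool) (r : Bool → Bool → ℝ) (u : Bool → ℝ)
    (j : Bool) :
    pmfExpect (N.channel k d) (fun x => N.thinnedRisk k r u x j) =
      (1 - N.maxErasure k) * r d j + N.maxErasure k * u j := by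
  simp only [pmfExpect_channel, thinnedRisk, Pi.add_apply, Pi.smul_apply, smul_eq_mul]
  linear_combination (r d j - u j) * N.mul_retention k d

/-- The risk, given the broadcasts of the first `k` nodes, of the randomized decision that
searches the last `n` of them, after thinning, for the most recent one which is not erased. If it
finds the broadcast `d` of node `i`, the decision has risk `r i d`. If it finds nothing, the
decision is `1`. -/
noncomputable def searchRisk (r : ℕ → Bool → Bool → ℝ) : (k n : ℕ) → History k → Bool → ℝ
  | k + 1, n + 1, h => N.thinnedRisk k (r k) (searchRisk r k n (Fin.tail h)) (h 0)
  | 0, _, _ => N.testError fun _ => true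
  | _ + 1, 0, _ => N.testError fun _ => true

variable {N} {r : ℕ → Bool → Bool → ℝ}

theorem searchRisk_mem_riskSet (hr : ∀ i d, r i d ∈ N.riskSet) :
    ∀ (k n : ℕ) (h : History k), N.searchRisk r k n h ∈ N.riskSet
  | k + 1, n + 1, _ => N.thinnedRisk_mem_riskSet (hr k) (searchRisk_mem_riskSet hr k n _) _
  | 0, _, _ => N.testError_mem_riskSet measurable_const
  | _ + 1, 0, _ => N.testError_mem_riskSet measurable_const

theorem searchRisk_congr :
    ∀ {k n : ℕ} {h h' : History k}, (∀ i : Fin k, i < n → h i = h' i) →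
      N.searchRisk r k n h = N.searchRisk r k n h'
  | k + 1, n + 1, h, h', heq => by
    have htail : N.searchRisk r k n (Fin.tail h) = N.searchRisk r k n (Fin.tail h') :=
      searchRisk_congr fun i hi => heq i.succ (Nat.succ_lt_succ hi)
    rw [searchRisk, searchRisk, htail, heq 0 n.succ_pos]
  | 0, _, _, _, _ => rfl
  | _ + 1, 0, _, _, _ => rfl

theorem searchRisk_factorsThrough_observed {k n : ℕ} (hn : n ≤ N.memory k) :
    (N.searchRisk r k n).FactorsThrough (N.observed k) := fun _ _ heq =>
  searchRisk_congr fun i hi => congrFun heq ⟨i, hi.trans_le hn⟩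

variable (N r) in
/-- The error probability of the randomized decision described at `searchRisk`. -/
noncomputable def searchError (t : ℕ → ℝ) (k n : ℕ) : ℝ :=
  ∑ j, N.prior j * pmfExpect (N.historyLaw t k j) fun h => N.searchRisk r k n h j

theorem searchError_succ (t : ℕ → ℝ) (k n : ℕ) :
    N.searchError r t (k + 1) (n + 1) =
      (1 - N.maxErasure k) * N.relayError t k (r k) +
        N.maxErasure k * N.searchError r t k n := by
  have hexpect : ∀ j,
      pmfExpect (N.historyLaw t (k + 1) j) (fun h => N.searchRisk r (k + 1) (n + 1) h j) =
        (1 - N.maxErasure k) * pmfExpect (N.nodeLaw t k j) (fun d => r k d j) +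
          N.maxErasure k * pmfExpect (N.historyLaw t k j) fun h => N.searchRisk r k n h j := by
    intro j
    simp only [historyLaw, nodeLaw, pmfExpect_bind, pmfExpect_map, searchRisk, Fin.cons_zero,
      Fin.tail_cons, pmfExpect_channel_thinnedRisk, pmfExpect_add, pmfExpect_const_mul,
      pmfExpect_const]
  simp only [searchError, relayError, hexpect, mul_add, Finset.sum_add_distrib, Finset.mul_sum,
    mul_left_comm]

theorem sum_prior_mul_testError_le_one (φ : S → Bool) :
    ∑ j, N.prior j * N.testError φ j ≤ 1 :=
  N.sum_prior ▸ Finset.sum_le_sum fun j _ =>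
    mul_le_of_le_one_right (N.prior_pos j).le (N.testError_le_one φ j)

theorem searchError_le {t : ℕ → ℝ} {B : ℝ} (hB : 0 ≤ B) :
    ∀ {k n : ℕ}, (∀ i ∈ Finset.Ico (k - n) k, N.relayError t i (r i) ≤ B) →
      N.searchError r t k n ≤ B + ∏ i ∈ Finset.Ico (k - n) k, N.maxErasure i
  | k + 1, n + 1, hr => by
    rw [Nat.add_sub_add_right] at hr ⊢
    have hle : k - n ≤ k := Nat.sub_le _ _
    have hk : N.relayError t k (r k) ≤ B := hr k (Finset.mem_Ico.2 ⟨hle, k.lt_succ_self⟩)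
    have ih : N.searchError r t k n ≤ B + ∏ i ∈ Finset.Ico (k - n) k, N.maxErasure i :=
      searchError_le hB fun i hi => hr i (Finset.Ico_subset_Ico_right k.le_succ hi)
    have hM := N.maxErasure_nonneg k
    have hM' := sub_nonneg.2 (N.maxErasure_le_one k)
    rw [searchError_succ, Finset.prod_Ico_succ_top hle]
    calc (1 - N.maxErasure k) * N.relayError t k (r k) + N.maxErasure k * N.searchError r t k n
        ≤ (1 - N.maxErasure k) * B +
            N.maxErasure k * (B + ∏ i ∈ Finset.Ico (k - n) k, N.maxErasure i) := by gcongr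
      _ = B + (∏ i ∈ Finset.Ico (k - n) k, N.maxErasure i) * N.maxErasure k := by ring
  | 0, _, _ => by
    simpa [searchError, searchRisk, pmfExpect_const] using
      (sum_prior_mul_testError_le_one _).trans (le_add_of_nonneg_left hB)
  | _ + 1, 0, _ => by
    simpa [searchError, searchRisk, pmfExpect_const] using
      (sum_prior_mul_testError_le_one _).trans (le_add_of_nonneg_left hB)

theorem tendsto_errorProb_priorOdds (hac : N.signalLaw true ≪ N.signalLaw false)
    (hunbdd : N.UnboundedSignals) {n : ℕ → ℕ} (hn : ∀ k, n k ≤ N.memory k)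
    (hstart : Tendsto (fun k => k - n k) atTop atTop)
    (herase : Tendsto (fun k => ∏ i ∈ Finset.Ico (k - n k) k, N.maxErasure i) atTop (𝓝 0)) :
    Tendsto (N.errorProb fun _ => N.priorOdds) atTop (𝓝 0) := by
  refine tendsto_zero_of_window_improvement (N.errorProb_nonneg _) (N.errorProb_le_one _) hstart
    herase fun δ hδ => ?_
  obtain ⟨η, hη, hrelay⟩ := N.exists_relayError_le hac hunbdd hδ
  refine ⟨η, hη, fun k M hM => ?_⟩
  choose r hr hrle using hrelay fun _ => N.priorOdds
  calc N.errorProb (fun _ => N.priorOdds) k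
      ≤ N.searchError r (fun _ => N.priorOdds) k (n k) :=
        N.errorProb_le_of_factorsThrough_observed hac rfl (searchRisk_mem_riskSet hr k (n k))
          (searchRisk_factorsThrough_observed (hn k))
    _ ≤ max δ (M - η) + ∏ i ∈ Finset.Ico (k - n k) k, N.maxErasure i :=
        searchError_le (le_max_of_le_left hδ.le) fun i hi =>
          (hrle i).trans (max_le_max_left δ (sub_le_sub_right (hM i hi) η))

end Search

section SearchLength

theorem searchLength_spec (k : ℕ) :
    N.searchLength k ^ 2 ≤ k ∧
      ∀ i ∈ Finset.Icc (k - N.searchLength k ^ 2) k, N.searchLength k ≤ N.memory i := by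
  classical
  exact Nat.findGreatest_spec
    (P := fun n => n ^ 2 ≤ k ∧ ∀ i ∈ Finset.Icc (k - n ^ 2) k, n ≤ N.memory i)
    (Nat.zero_le k) ⟨by simp, fun i _ => Nat.zero_le _⟩

theorem searchLength_le_memory (k : ℕ) : N.searchLength k ≤ N.memory k :=
  (N.searchLength_spec k).2 k (by simp)

theorem tendsto_searchLength (hmem : Tendsto N.memory atTop atTop) :
    Tendsto N.searchLength atTop atTop := by
  refine tendsto_atTop.2 fun n => ?_
  obtain ⟨k₀, hk₀⟩ := eventually_atTop.1 (hmem.eventually_ge_atTop n)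
  filter_upwards [eventually_ge_atTop (k₀ + n ^ 2)] with k hk
  have hn : n ≤ n ^ 2 := Nat.le_self_pow two_ne_zero n
  classical
  refine Nat.le_findGreatest (by omega) ⟨by omega, fun i hi => hk₀ i ?_⟩
  have := (Finset.mem_Icc.1 hi).1
  omega

theorem tendsto_sub_searchLength : Tendsto (fun k => k - N.searchLength k) atTop atTop := by
  refine tendsto_atTop.2 fun b => ?_
  filter_upwards [eventually_ge_atTop (2 * b + 2)] with k hk
  have hsq : N.searchLength k ^ 2 ≤ k := (N.searchLength_spec k).1
  have hlin : 2 * N.searchLength k ≤ N.searchLength k ^ 2 + 1 := by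
    simpa using two_mul_le_add_sq (N.searchLength k) 1
  omega

end SearchLength

end ErasureNetwork

theorem theorem3_general {S : Type*} [MeasurableSpace S] (N : ErasureNetwork S)
    (hac : N.signalLaw true ≪ N.signalLaw false) (hunbdd : N.UnboundedSignals)
    {n : ℕ → ℕ} (hn_le : ∀ k, n k ≤ N.memory k) (hn : Tendsto n atTop atTop)
    (hstart : Tendsto (fun k => k - n k) atTop atTop)
    {ε c : ℝ} (hε : 0 < ε) (hc : 0 < c)
    (hbound :
      (∀ᶠ k in atTop, ∀ i ∈ Finset.Ico (k - n k) k, ∀ j,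
        (N.erasureProb i j : ℝ) ≤ (c * (n k : ℝ)) ^ (-ε / (n k : ℝ))) ∨
      ((∀ᶠ k in atTop, ∀ j,
        (N.erasureProb k j : ℝ) ≤ (c * (n k : ℝ)) ^ (-ε / (n k : ℝ))) ∧
        ∃ K : ℝ, ∀ᶠ k in atTop, ∀ i ∈ Finset.Ico (k - n k) k, (n i : ℝ) ≤ K * (n k : ℝ))) :
    Tendsto (N.errorProb fun _ => N.priorOdds) atTop (𝓝 0) := by
  refine ErasureNetwork.tendsto_errorProb_priorOdds hac hunbdd hn_le hstart ?_
  have hn_le' : ∀ k, n k ≤ k := fun k => (hn_le k).trans (N.memory_le k)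
  rcases hbound with hwindow | ⟨hnode, K, hK⟩
  · exact tendsto_prod_window_of_le_rpow N.maxErasure_nonneg hn_le' hn hε hc
      (hwindow.mono fun k hk i hi => N.maxErasure_le (hk i hi))
  · exact tendsto_prod_window_of_le_rpow_self N.maxErasure_nonneg hn_le' hn hstart hε hc
      (hnode.mono fun k hk => N.maxErasure_le hk) hK

theorem theorem3 {S : Type*} [MeasurableSpace S] (N : ErasureNetwork S)
    (hequiv : N.EquivalentSignals) (hunbdd : N.UnboundedSignals)
    (hmem : Tendsto N.memory atTop atTop)
    (ε c : ℝ) (hε : 1 < ε) (hc : 0 < c)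
    (hbound :
      (∀ᶠ k in atTop, ∀ i ∈ Finset.Ico (k - N.searchLength k) k, ∀ j,
        (N.erasureProb i j : ℝ) ≤
          (c * (N.searchLength k : ℝ)) ^ (-ε / (N.searchLength k : ℝ))) ∨
      ((∀ᶠ k in atTop, ∀ j,
        (N.erasureProb k j : ℝ) ≤
          (c * (N.searchLength k : ℝ)) ^ (-ε / (N.searchLength k : ℝ))) ∧
        ∃ K : ℝ, ∀ᶠ k in atTop, ∀ i ∈ Finset.Ico (k - N.searchLength k) k,
          (N.searchLength i : ℝ) ≤ K * (N.searchLength k : ℝ))) :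
    ∃ t : ℕ → ℝ, (∀ k, 0 < t k) ∧ Tendsto (N.errorProb t) atTop (𝓝 0) :=
  ⟨fun _ => N.priorOdds, fun _ => N.priorOdds_pos,
    theorem3_general N hequiv.2 hunbdd N.searchLength_le_memory (N.tendsto_searchLength hmem)
      N.tendsto_sub_searchLength (zero_lt_one.trans hε) hc hbound⟩
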